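/- Let $n,m\ge 0$ be integers, let $f:\mathbb R^n\to\mathbb R^n$ be (globally) Lipschitz continuous, let $B\in\mathbb R^{n\times m}$ have columns $B_{\bullet 1},\dots,B_{\bullet m}$, let $\rho_1,\dots,\rho_m$ be real numbers, and let $\gamma=(\gamma_1,\dots,\gamma_m):[0,\infty)\to\mathbb R^m$ be Lebesgue measurable with $|\gamma_i(t)|<\rho_i$ for all $1\le i\le m$ and all $t\ge 0$. Let $P=P^T>0$ be a real $n\times n$ matrix and $V(x)=\tfrac12 x^TPx$. Let $\mathrm{sgn}$ be the multivalued sign function: $\mathrm{sgn}(r)=\{1\}$ for $r>0$, $\{-1\}$ for $r<0$, and $\mathrm{sgn}(0)=[-1,1]$. Consider $$\dot x(t)\in f(x(t))-\sum_{i=1}^m\rho_i B_{\bullet i}\,\mathrm{sgn}\big(\nabla V(x(t))^TB_{\bullet i}\big)+\sum_{i=1}^m B_{\bullet i}\gamma_i(t)\quad\text{for a.e. } t>0,\qquad x(0)=x_0. \tag{$*$}$$ A solution of $(*)$ is a function $x:[0,\infty)\to\mathbb R^n$ that is absolutely continuous on every $[0,T]$ and satisfies $(*)$. Then for every $x_0\in\mathbb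 R^n$ the inclusion $(*)$ has exactly one solution on $[0,\infty)$, and this solution is Lipschitz continuous on $[0,T]$ for every $T\geq 0$. If moreover $V$ is a Lyapunov function of the free system $\dot x=f(x)$, in the sense that $\nabla V(z)^Tf(z)\le 0$ for all $z\in\mathbb R^n$, then the solution is Lipschitz continuous on all of $[0,\infty)$ (with one Lipschitz constant). -/

import Mathlib

open MeasureTheory Set

noncomputable section

/-- The multivalued sign function: `{1}` for positive, `{-1}` for negative arguments, and the whole
interval `[-1, 1]` at zero. -/
def multiSgn (r : ℝ) : Set ℝ :=
  {s | (0 < r → s = 1) ∧ (r < 0 → s = -1) ∧ (r = 0 → s ∈ Icc (-1 : ℝ) 1)}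

/-- The `i`-th column of an `n × m` matrix, as a vector of Euclidean space. -/
def euclCol {n m : ℕ} (B : Matrix (Fin n) (Fin m) ℝ) (i : Fin m) : EuclideanSpace ℝ (Fin n) :=
  WithLp.toLp 2 (fun j => B j i)

/-- The quadratic function `V(x) = (1/2) xᵀ P x`. -/
def quadV {n : ℕ} (P : Matrix (Fin n) (Fin n) ℝ) (x : EuclideanSpace ℝ (Fin n)) : ℝ :=
  (1 / 2) * (x.ofLp ⬝ᵥ P.mulVec x.ofLp)

/-- The multivalued right-hand side
`f(x) - ∑ ρ i • B_i • sgn(∇V(x)ᵀ B_i) + ∑ γ_i(t) • B_i` of the closed-loop system, where `B_i` is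
the `i`-th column of `B`; every `sgn` is selected independently. -/
def closedLoop {n m : ℕ} (f : EuclideanSpace ℝ (Fin n) → EuclideanSpace ℝ (Fin n))
    (B : Matrix (Fin n) (Fin m) ℝ) (ρ : Fin m → ℝ) (V : EuclideanSpace ℝ (Fin n) → ℝ)
    (γ : ℝ → Fin m → ℝ) (t : ℝ) (x : EuclideanSpace ℝ (Fin n)) :
    Set (EuclideanSpace ℝ (Fin n)) :=
  {v | ∃ s : Fin m → ℝ, (∀ i, s i ∈ multiSgn (inner ℝ (gradient V x) (euclCol B i))) ∧
    v = f x - ∑ i, (ρ i * s i) • euclCol B i + ∑ i, γ t i • euclCol B i}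

/-- `x` is a solution on `[0, ∞)` of `ẋ(t) ∈ F t (x t)`, `x 0 = x₀`: it is absolutely continuous on
every `[0, T]` and satisfies the inclusion for almost every `t > 0`. Only the values of `x` on
`[0, ∞)` matter. -/
structure IsSolution {n : ℕ}
    (F : ℝ → EuclideanSpace ℝ (Fin n) → Set (EuclideanSpace ℝ (Fin n)))
    (x₀ : EuclideanSpace ℝ (Fin n)) (x : ℝ → EuclideanSpace ℝ (Fin n)) : Prop where
  init : x 0 = x₀
  absCont : ∀ T : ℝ, 0 ≤ T → AbsolutelyContinuousOnInterval x 0 T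
  incl : ∀ᵐ t ∂(volume.restrict (Ioi (0 : ℝ))), ∃ v ∈ F t (x t), HasDerivAt x v t

end

/-! ### Absolutely continuous curves: Gronwall and energy estimates -/

section AbsolutelyContinuous

/-! Since `∇V(x) = P x`, the switching arguments are `⟪P x, B_i⟫`, so monotonicity of `sgn` makes
`G(x) = f(x) - ∑ ρ_i B_i sgn⟪P x, B_i⟫` one-sided Lipschitz in the inner product defined by `P`,
although it is discontinuous (`inner_signField_sub_le`). Gronwall for `⟪P Z, Z⟫`, with `Z` the
difference of two solutions, gives uniqueness: the disturbance cancels in `Z'`.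

For existence, put `Γ(t) = ∫₀ᵗ ∑ γ_i B_i`, which is Lipschitz, and solve `y' ∈ G(y + Γ)`; then `x =
y + Γ`. Euler polygons built from an arbitrary selection of `G` form a Cauchy sequence by the same
one-sided estimate, so no compactness argument is needed (`exists_norm_eulerPrimitive_sub_sq_le`).
The limit satisfies the inclusion because `G` is upper semicontinuous with closed convex values
(`exists_lipschitz_arc_deriv_mem`).

If `V` is a Lyapunov function of the free system, then `|γ_i| ≤ ρ_i` keeps `V` nonincreasing along
the solution. The solution is then bounded, hence so is its velocity. -/

theorem LipschitzOnWith.comp_absolutelyContinuousOnInterval {X Y : Type*} [PseudoMetricSpace X]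
    [PseudoMetricSpace Y] {K : NNReal} {g : X → Y} {s : Set X} (hg : LipschitzOnWith K g s)
    {f : ℝ → X} {a b : ℝ} (hf : AbsolutelyContinuousOnInterval f a b)
    (hfs : MapsTo f (uIcc a b) s) : AbsolutelyContinuousOnInterval (fun t => g (f t)) a b := by
  rw [absolutelyContinuousOnInterval_iff] at hf ⊢
  intro ε hε
  obtain ⟨δ, hδ, h⟩ := hf (ε / (K + 1)) (by positivity)
  refine ⟨δ, hδ, fun E hE hEδ => ?_⟩
  have h1 := h E hE hEδ
  have h2 : ∑ i ∈ Finset.range E.1, dist (g (f (E.2 i).1)) (g (f (E.2 i).2)) ≤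
      K * ∑ i ∈ Finset.range E.1, dist (f (E.2 i).1) (f (E.2 i).2) := by
    rw [Finset.mul_sum]
    exact Finset.sum_le_sum fun i hi =>
      hg.dist_le_mul _ (hfs (hE.1 i hi).1) _ (hfs (hE.1 i hi).2)
  have h3 : (0 : ℝ) ≤ ∑ i ∈ Finset.range E.1, dist (f (E.2 i).1) (f (E.2 i).2) :=
    Finset.sum_nonneg fun _ _ => dist_nonneg
  rw [lt_div_iff₀ (by positivity)] at h1
  nlinarith

theorem LipschitzWith.comp_absolutelyContinuousOnInterval {X Y : Type*} [PseudoMetricSpace X]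
    [PseudoMetricSpace Y] {K : NNReal} {g : X → Y} (hg : LipschitzWith K g)
    {f : ℝ → X} {a b : ℝ} (hf : AbsolutelyContinuousOnInterval f a b) :
    AbsolutelyContinuousOnInterval (fun t => g (f t)) a b :=
  (hg.lipschitzOnWith (s := univ)).comp_absolutelyContinuousOnInterval hf (mapsTo_univ _ _)

theorem AbsolutelyContinuousOnInterval.sub_le_of_ae_hasDerivAt_le {φ φ' : ℝ → ℝ} {a b M : ℝ}
    (hab : a ≤ b) (hφ : AbsolutelyContinuousOnInterval φ a b)
    (hd : ∀ᵐ t, t ∈ Ioc a b → HasDerivAt φ (φ' t) t ∧ φ' t ≤ M) :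
    φ b - φ a ≤ M * (b - a) := by
  rw [← hφ.integral_deriv_eq_sub]
  have h : ∫ t in a..b, deriv φ t ≤ ∫ _ in a..b, M := by
    rw [intervalIntegral.integral_of_le hab, intervalIntegral.integral_of_le hab]
    refine setIntegral_mono_ae_restrict ((intervalIntegrable_iff_integrableOn_Ioc_of_le hab).1
      hφ.intervalIntegrable_deriv) (by simp) ?_
    rw [Filter.EventuallyLE, ae_restrict_iff' measurableSet_Ioc]
    filter_upwards [hd] with t ht hm
    rw [(ht hm).1.deriv]
    exact (ht hm).2
  simpa [mul_comm] using h

/-- The integrating factor `exp (-K t)` lies in `(0, 1]`, so its product with `φ` has derivative at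
most `D`. No sign of `φ` is needed. -/
theorem AbsolutelyContinuousOnInterval.le_gronwall {φ φ' : ℝ → ℝ} {b K D : ℝ} (hb : 0 ≤ b)
    (hK : 0 ≤ K) (hD : 0 ≤ D) (hφ : AbsolutelyContinuousOnInterval φ 0 b)
    (hd : ∀ᵐ t, t ∈ Ioc 0 b → HasDerivAt φ (φ' t) t ∧ φ' t ≤ K * φ t + D) :
    φ b ≤ (φ 0 + D * b) * Real.exp (K * b) := by
  have hexp : AbsolutelyContinuousOnInterval (fun t => Real.exp (-K * t)) 0 b := by
    have h : LipschitzOnWith 1 Real.exp (Iic 0) := by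
      refine (convex_Iic 0).lipschitzOnWith_of_nnnorm_deriv_le
        (fun x _ => Real.differentiableAt_exp) fun x hx => ?_
      rw [Real.deriv_exp, ← NNReal.coe_le_coe]
      simpa using hx
    have h2 : AbsolutelyContinuousOnInterval (fun t : ℝ => -K * t) 0 b :=
      (LipschitzWith.id.lipschitzOnWith.absolutelyContinuousOnInterval).const_mul (-K)
    refine h.comp_absolutelyContinuousOnInterval h2 fun t ht => ?_
    rw [uIcc_of_le hb] at ht
    have := mul_nonneg hK ht.1
    simp only [mem_Iic]; linarith
  have key := (hexp.fun_mul hφ).sub_le_of_ae_hasDerivAt_le hb (M := D)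
    (φ' := fun t => Real.exp (-K * t) * (-K) * φ t + Real.exp (-K * t) * φ' t) ?_
  · simp only [mul_zero, Real.exp_zero, one_mul, sub_zero] at key
    have h1 : Real.exp (-K * b) * φ b ≤ φ 0 + D * b := by linarith
    have h2 := mul_le_mul_of_nonneg_right h1 (Real.exp_pos (K * b)).le
    have h3 : Real.exp (-K * b) * Real.exp (K * b) = 1 := by
      rw [← Real.exp_add]; simp
    calc φ b = Real.exp (-K * b) * Real.exp (K * b) * φ b := by rw [h3, one_mul]
      _ = Real.exp (-K * b) * φ b * Real.exp (K * b) := by ring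
      _ ≤ _ := h2
  · filter_upwards [hd] with t ht hm
    obtain ⟨h1, h2⟩ := ht hm
    refine ⟨?_, ?_⟩
    · have h3 : HasDerivAt (fun t => Real.exp (-K * t)) (Real.exp (-K * t) * (-K)) t := by
        simpa using ((hasDerivAt_id t).const_mul (-K)).exp
      exact h3.mul h1
    · have h4 : Real.exp (-K * t) ≤ 1 := by
        rw [Real.exp_le_one_iff]
        nlinarith [mul_nonneg hK hm.1.le]
      have h5 := (Real.exp_pos (-K * t)).le
      calc Real.exp (-K * t) * (-K) * φ t + Real.exp (-K * t) * φ' t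
          = Real.exp (-K * t) * (φ' t - K * φ t) := by ring
        _ ≤ Real.exp (-K * t) * D := mul_le_mul_of_nonneg_left (by linarith) h5
        _ ≤ D := by nlinarith

variable {E : Type*} [NormedAddCommGroup E] [InnerProductSpace ℝ E]

/-- Pairing the curve with its own increment `v` reduces the bound to the scalar case. -/
theorem AbsolutelyContinuousOnInterval.dist_le_of_ae_hasDerivAt {x x' : ℝ → E} {a b M : ℝ}
    (hab : a ≤ b) (hx : AbsolutelyContinuousOnInterval x a b)
    (hd : ∀ᵐ t, t ∈ Ioc a b → HasDerivAt x (x' t) t ∧ ‖x' t‖ ≤ M) :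
    dist (x a) (x b) ≤ M * (b - a) := by
  set v := x b - x a with hv
  have h1 : AbsolutelyContinuousOnInterval (fun t => innerSL ℝ v (x t)) a b :=
    (innerSL ℝ v).lipschitz.comp_absolutelyContinuousOnInterval hx
  have h2 := h1.sub_le_of_ae_hasDerivAt_le hab (φ' := fun t => innerSL ℝ v (x' t)) (M := ‖v‖ * M) (by
    filter_upwards [hd] with t ht hm
    refine ⟨(innerSL ℝ v).hasFDerivAt.comp_hasDerivAt t (ht hm).1, ?_⟩
    exact (real_inner_le_norm _ _).trans (mul_le_mul_of_nonneg_left (ht hm).2 (norm_nonneg _)))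
  rw [← map_sub, ← hv, innerSL_apply_apply, real_inner_self_eq_norm_sq] at h2
  rw [dist_comm, dist_eq_norm, ← hv]
  rcases (norm_nonneg v).eq_or_lt with h0 | h0
  · rcases hab.eq_or_lt with rfl | hab'
    · rw [← h0]; simp
    · rw [← h0]
      -- `0 ≤ M` is not assumed; it follows because the derivative bound holds somewhere on a set of
      -- positive measure.
      have hne : (volume (Ioc a b)) ≠ 0 := by simp [hab']
      have hM : 0 ≤ M := by
        by_contra hM
        apply hne
        refine measure_mono_null (fun t ht => ?_) hd
        intro h
        exact hM ((norm_nonneg _).trans (h ht).2)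
      exact mul_nonneg hM (by linarith)
  · nlinarith

theorem inner_map_self_sub {A : E →L[ℝ] E} (hA : ∀ x y, inner ℝ (A x) y = inner ℝ x (A y))
    (z w : E) : inner ℝ (A z) z - inner ℝ (A w) w = inner ℝ (A (z + w)) (z - w) := by
  have h1 : inner ℝ (A w) z = inner ℝ (A z) w := by rw [hA, real_inner_comm]
  rw [map_add, inner_add_left, inner_sub_right, inner_sub_right, h1]
  ring

/-- The quadratic form is only locally Lipschitz; this suffices because the curve stays in a ball.
-/
theorem AbsolutelyContinuousOnInterval.inner_map_self {A : E →L[ℝ] E}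
    (hA : ∀ x y, inner ℝ (A x) y = inner ℝ x (A y)) {Z : ℝ → E} {a b : ℝ}
    (hZ : AbsolutelyContinuousOnInterval Z a b) :
    AbsolutelyContinuousOnInterval (fun t => inner ℝ (A (Z t)) (Z t)) a b := by
  obtain ⟨R, hR⟩ := hZ.exists_bound
  have h : LipschitzOnWith (Real.toNNReal (‖A‖ * (R + R))) (fun z => inner ℝ (A z) z)
      {z : E | ‖z‖ ≤ R} := by
    refine LipschitzOnWith.of_dist_le_mul fun z hz w hw => ?_
    have hz' : ‖z‖ ≤ R := hz
    have hw' : ‖w‖ ≤ R := hw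
    have hR0 : 0 ≤ R := (norm_nonneg z).trans hz'
    rw [Real.coe_toNNReal _ (by positivity), Real.dist_eq, inner_map_self_sub hA, dist_eq_norm]
    refine (abs_real_inner_le_norm _ _).trans ?_
    gcongr
    refine (A.le_opNorm _).trans ?_
    gcongr
    exact (norm_add_le _ _).trans (add_le_add hz' hw')
  exact h.comp_absolutelyContinuousOnInterval hZ hR

theorem hasDerivAt_inner_map_self {A : E →L[ℝ] E}
    (hA : ∀ x y, inner ℝ (A x) y = inner ℝ x (A y)) {Z : ℝ → E} {v : E} {t : ℝ}
    (h : HasDerivAt Z v t) :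
    HasDerivAt (fun t => inner ℝ (A (Z t)) (Z t)) (2 * inner ℝ (A (Z t)) v) t := by
  have h1 := (A.hasFDerivAt.comp_hasDerivAt t h).inner ℝ h
  convert! h1 using 1
  simp only [Function.comp]
  rw [hA v, real_inner_comm v]; ring

/-- The common energy estimate: used with `D > 0` to compare Euler arcs, `D = 0` for uniqueness, and
`K = D = 0` for boundedness under the Lyapunov condition. -/
theorem AbsolutelyContinuousOnInterval.inner_map_self_le_gronwall {A : E →L[ℝ] E}
    (hA : ∀ x y, inner ℝ (A x) y = inner ℝ x (A y)) {c K D : ℝ} (hc : 0 < c)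
    (hcA : ∀ x, c * ‖x‖ ^ 2 ≤ inner ℝ (A x) x) (hK : 0 ≤ K) (hD : 0 ≤ D)
    {Z Z' : ℝ → E} {b : ℝ} (hb : 0 ≤ b) (hZ : AbsolutelyContinuousOnInterval Z 0 b)
    (hd : ∀ᵐ t, t ∈ Ioc 0 b →
      HasDerivAt Z (Z' t) t ∧ inner ℝ (A (Z t)) (Z' t) ≤ K * ‖Z t‖ ^ 2 + D) :
    c * ‖Z b‖ ^ 2 ≤ (inner ℝ (A (Z 0)) (Z 0) + 2 * D * b) * Real.exp (2 * K / c * b) := by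
  refine (hcA _).trans ((hZ.inner_map_self hA).le_gronwall hb (by positivity) (by positivity)
    (φ' := fun t => 2 * inner ℝ (A (Z t)) (Z' t)) ?_)
  filter_upwards [hd] with t ht hm
  refine ⟨hasDerivAt_inner_map_self hA (ht hm).1, ?_⟩
  have h1 := (ht hm).2
  have h2 : K * ‖Z t‖ ^ 2 ≤ K / c * inner ℝ (A (Z t)) (Z t) := by
    rw [div_mul_eq_mul_div, le_div_iff₀ hc]
    nlinarith [mul_le_mul_of_nonneg_left (hcA (Z t)) hK]
  have h3 : 2 * K / c * inner ℝ (A (Z t)) (Z t) = 2 * (K / c * inner ℝ (A (Z t)) (Z t)) := by ring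
  rw [h3]; linarith

end AbsolutelyContinuous

/-! ### Euler polygons and their mutual distance -/

noncomputable section EulerPolygon

variable {E : Type*} [NormedAddCommGroup E] [InnerProductSpace ℝ E]

/-- The nodes of the explicit Euler scheme with step `h` for `x' = g x + Γ'`. -/
def eulerNode (g : E → E) (Γ : ℝ → E) (x₀ : E) (h : ℝ) : ℕ → E
  | 0 => x₀
  | j + 1 => eulerNode g Γ x₀ h j + h • g (eulerNode g Γ x₀ h j) + (Γ ((j + 1 : ℕ) * h) - Γ (j * h))

/-- The piecewise constant interpolation of the Euler nodes. -/
def eulerStep (g : E → E) (Γ : ℝ → E) (x₀ : E) (h t : ℝ) : E :=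
  eulerNode g Γ x₀ h ⌊t / h⌋₊

/-- The absolutely continuous part of the Euler arc. -/
def eulerPrimitive (g : E → E) (Γ : ℝ → E) (x₀ : E) (h t : ℝ) : E :=
  x₀ + ∫ τ in (0 : ℝ)..t, g (eulerStep g Γ x₀ h τ)

variable {g : E → E} {Γ : ℝ → E} {x₀ : E} {h : ℝ}

/-- `g` need not be measurable: the integrand factors through `ℕ` and is bounded by finitely many
nodal values. -/
theorem intervalIntegrable_eulerStep [FiniteDimensional ℝ E] (hh : 0 < h) (a b : ℝ) :
    IntervalIntegrable (fun τ => g (eulerStep g Γ x₀ h τ)) volume a b := by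
  borelize E
  have hm : Measurable (fun τ => g (eulerStep g Γ x₀ h τ)) := by
    have h1 : Measurable fun j : ℕ => g (eulerNode g Γ x₀ h j) := measurable_from_top
    exact h1.comp (Nat.measurable_floor.comp (measurable_id.div_const h))
  have hprop : ProperSpace E := FiniteDimensional.proper_real E
  rw [intervalIntegrable_iff]
  refine Measure.integrableOn_of_bounded (M := ∑ j ∈ Finset.range (⌊max a b / h⌋₊ + 1),
    ‖g (eulerNode g Γ x₀ h j)‖) (by simp [uIoc]) hm.aestronglyMeasurable ?_
  rw [ae_restrict_iff' measurableSet_uIoc]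
  refine Filter.Eventually.of_forall fun t ht => ?_
  refine Finset.single_le_sum (f := fun j => ‖g (eulerNode g Γ x₀ h j)‖)
    (fun _ _ => norm_nonneg _) (a := ⌊t / h⌋₊) ?_
  rw [Finset.mem_range, Nat.lt_succ_iff]
  exact Nat.floor_mono (by gcongr; exact ht.2)

theorem eulerPrimitive_node [FiniteDimensional ℝ E] (hh : 0 < h) (hΓ0 : Γ 0 = 0) (j : ℕ) :
    eulerPrimitive g Γ x₀ h (j * h) + Γ (j * h) = eulerNode g Γ x₀ h j := by
  induction j with
  | zero => simp [eulerPrimitive, eulerNode, hΓ0]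
  | succ j ih =>
    have h1 : ∫ τ in (j * h : ℝ)..((j + 1 : ℕ) * h), g (eulerStep g Γ x₀ h τ) =
        h • g (eulerNode g Γ x₀ h j) := by
      have hle : (j * h : ℝ) ≤ (j + 1 : ℕ) * h := by push_cast; nlinarith
      rw [intervalIntegral.integral_of_le hle, integral_Ioc_eq_integral_Ioo,
        setIntegral_congr_fun (g := fun _ => g (eulerNode g Γ x₀ h j)) measurableSet_Ioo ?_]
      · rw [setIntegral_const, measureReal_def, Real.volume_Ioo]
        congr 1
        rw [ENNReal.toReal_ofReal (by linarith)]
        push_cast; ring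
      · intro t ht
        have : ⌊t / h⌋₊ = j := by
          rw [Nat.floor_eq_iff (div_nonneg ((by positivity : (0 : ℝ) ≤ j * h).trans ht.1.le) hh.le),
            le_div_iff₀ hh, div_lt_iff₀ hh]
          exact ⟨ht.1.le, by have := ht.2; push_cast at this; exact this⟩
        simp only [eulerStep, this]
    have h2 := intervalIntegral.integral_add_adjacent_intervals
      (intervalIntegrable_eulerStep (g := g) (Γ := Γ) (x₀ := x₀) hh 0 (j * h))
      (intervalIntegrable_eulerStep (g := g) (Γ := Γ) (x₀ := x₀) hh (j * h) ((j + 1 : ℕ) * h))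
    rw [eulerPrimitive] at ih ⊢
    rw [eulerNode, ← h2, h1, ← ih]
    abel

/-- The shift by 2 absorbs the affine growth of `g` and the increment of `Γ`, making the recursion
purely geometric with ratio `1 + h * L`. -/
theorem norm_eulerNode_le {L : NNReal} (hg : ∀ x, ‖g x‖ ≤ L * (1 + ‖x‖))
    (hΓ : LipschitzWith L Γ) (hh : 0 < h) (j : ℕ) :
    ‖eulerNode g Γ x₀ h j‖ + 2 ≤ (1 + h * L) ^ j * (‖x₀‖ + 2) := by
  induction j with
  | zero => simp [eulerNode]
  | succ j ih =>
    have h1 : ‖Γ ((j + 1 : ℕ) * h) - Γ (j * h)‖ ≤ L * h := by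
      rw [← dist_eq_norm]
      refine (hΓ.dist_le_mul _ _).trans_eq ?_
      rw [Real.dist_eq]; push_cast
      rw [show ((j : ℝ) + 1) * h - j * h = h by ring, abs_of_pos hh]
    have h2 := hg (eulerNode g Γ x₀ h j)
    have h3 : ‖h • g (eulerNode g Γ x₀ h j)‖ ≤ h * (L * (1 + ‖eulerNode g Γ x₀ h j‖)) := by
      rw [norm_smul, Real.norm_of_nonneg hh.le]; gcongr
    calc ‖eulerNode g Γ x₀ h (j + 1)‖ + 2
        ≤ ‖eulerNode g Γ x₀ h j‖ + h * (L * (1 + ‖eulerNode g Γ x₀ h j‖)) + L * h + 2 := by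
          rw [eulerNode]
          gcongr
          refine (norm_add₃_le).trans ?_
          gcongr
      _ = (1 + h * L) * (‖eulerNode g Γ x₀ h j‖ + 2) := by ring
      _ ≤ (1 + h * L) * ((1 + h * L) ^ j * (‖x₀‖ + 2)) := by gcongr
      _ = _ := by ring

/-- An a priori bound for the Euler scheme on `[0, T]`. -/
def eulerBound {F : Type*} [NormedAddCommGroup F] (L : NNReal) (x₀ : F) (T : ℝ) : ℝ :=
  Real.exp (L * T) * (‖x₀‖ + 2)

theorem eulerBound_nonneg {F : Type*} [NormedAddCommGroup F] (L : NNReal) (x₀ : F) (T : ℝ) : 0 ≤ eulerBound L x₀ T := by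
  unfold eulerBound; positivity

variable {L : NNReal} {T t : ℝ}

theorem norm_eulerStep_le (hg : ∀ x, ‖g x‖ ≤ L * (1 + ‖x‖))
    (hΓ : LipschitzWith L Γ) (hh : 0 < h) (ht : t ∈ Icc 0 T) :
    ‖eulerStep g Γ x₀ h t‖ ≤ eulerBound L x₀ T := by
  have h1 := norm_eulerNode_le (x₀ := x₀) hg hΓ hh ⌊t / h⌋₊
  have h2 : (⌊t / h⌋₊ : ℝ) * h ≤ t := by
    rw [← le_div_iff₀ hh]; exact Nat.floor_le (div_nonneg ht.1 hh.le)
  have h3 : (1 + h * L) ^ ⌊t / h⌋₊ ≤ Real.exp (L * T) := by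
    calc (1 + h * L) ^ ⌊t / h⌋₊ ≤ Real.exp (h * L) ^ ⌊t / h⌋₊ := by
          gcongr
          linarith [Real.add_one_le_exp (h * L)]
      _ = Real.exp (L * (⌊t / h⌋₊ * h)) := by rw [← Real.exp_nat_mul]; congr 1; ring
      _ ≤ _ := by gcongr; exact h2.trans ht.2
  have h4 : (1 + h * L) ^ ⌊t / h⌋₊ * (‖x₀‖ + 2) ≤ eulerBound L x₀ T := by
    unfold eulerBound; gcongr
  unfold eulerStep
  linarith

theorem norm_apply_eulerStep_le (hg : ∀ x, ‖g x‖ ≤ L * (1 + ‖x‖))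
    (hΓ : LipschitzWith L Γ) (hh : 0 < h) (ht : t ∈ Icc 0 T) :
    ‖g (eulerStep g Γ x₀ h t)‖ ≤ L * (1 + eulerBound L x₀ T) := by
  refine (hg _).trans ?_
  gcongr
  exact norm_eulerStep_le hg hΓ hh ht

theorem eulerPrimitive_sub [FiniteDimensional ℝ E] (hh : 0 < h) (s t : ℝ) :
    eulerPrimitive g Γ x₀ h t - eulerPrimitive g Γ x₀ h s =
      ∫ τ in s..t, g (eulerStep g Γ x₀ h τ) := by
  rw [← intervalIntegral.integral_interval_sub_left (intervalIntegrable_eulerStep hh 0 t)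
    (intervalIntegrable_eulerStep hh 0 s)]
  unfold eulerPrimitive; abel

theorem lipschitzOnWith_eulerPrimitive [FiniteDimensional ℝ E]
    (hg : ∀ x, ‖g x‖ ≤ L * (1 + ‖x‖)) (hΓ : LipschitzWith L Γ) (hh : 0 < h) :
    LipschitzOnWith (Real.toNNReal (L * (1 + eulerBound L x₀ T)))
      (eulerPrimitive g Γ x₀ h) (Icc 0 T) := by
  refine LipschitzOnWith.of_dist_le_mul fun s hs t ht => ?_
  have := eulerBound_nonneg L x₀ T
  rw [Real.coe_toNNReal _ (by positivity), dist_eq_norm, eulerPrimitive_sub hh, Real.dist_eq]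
  refine intervalIntegral.norm_integral_le_of_norm_le_const fun τ hτ => ?_
  exact norm_apply_eulerStep_le hg hΓ hh ((convex_Icc (0 : ℝ) T).ordConnected.uIcc_subset ht hs
    (uIoc_subset_uIcc hτ))

theorem dist_eulerPrimitive_eulerStep_le [FiniteDimensional ℝ E]
    (hg : ∀ x, ‖g x‖ ≤ L * (1 + ‖x‖)) (hΓ : LipschitzWith L Γ) (hΓ0 : Γ 0 = 0) (hh : 0 < h)
    (ht : t ∈ Icc 0 T) :
    ‖eulerPrimitive g Γ x₀ h t + Γ t - eulerStep g Γ x₀ h t‖ ≤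
      L * (2 + eulerBound L x₀ T) * h := by
  have h2 : (⌊t / h⌋₊ : ℝ) * h ≤ t := by
    rw [← le_div_iff₀ hh]; exact Nat.floor_le (div_nonneg ht.1 hh.le)
  have h3 : t - ⌊t / h⌋₊ * h ≤ h := by
    have := (Nat.lt_floor_add_one (t / h)).le
    rw [div_le_iff₀ hh] at this
    linarith
  have h4 : (⌊t / h⌋₊ : ℝ) * h ∈ Icc 0 T := ⟨by positivity, h2.trans ht.2⟩
  have hB := eulerBound_nonneg L x₀ T
  have h5 := (lipschitzOnWith_eulerPrimitive (x₀ := x₀) (T := T) hg hΓ hh).dist_le_mul _ ht _ h4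
  have h6 := hΓ.dist_le_mul t (⌊t / h⌋₊ * h)
  rw [Real.coe_toNNReal _ (by positivity)] at h5
  rw [Real.dist_eq, abs_of_nonneg (by linarith), dist_eq_norm] at h5 h6
  rw [eulerStep, ← eulerPrimitive_node hh hΓ0, add_sub_add_comm]
  refine (norm_add_le _ _).trans ((add_le_add h5 h6).trans ?_)
  rw [← add_mul]
  calc _ ≤ (L * (1 + eulerBound L x₀ T) + L) * h := by gcongr
    _ = _ := by ring

theorem ae_hasDerivAt_eulerPrimitive [FiniteDimensional ℝ E] (hh : 0 < h) :
    ∀ᵐ t, HasDerivAt (eulerPrimitive g Γ x₀ h) (g (eulerStep g Γ x₀ h t)) t := by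
  have hc : CompleteSpace E := FiniteDimensional.complete ℝ E
  have hl : LocallyIntegrable (fun τ => g (eulerStep g Γ x₀ h τ)) volume := by
    refine fun t => ⟨Ioc (t - 1) (t + 1), Ioc_mem_nhds (by linarith) (by linarith), ?_⟩
    exact (intervalIntegrable_iff_integrableOn_Ioc_of_le (by linarith)).1
      (intervalIntegrable_eulerStep hh _ _)
  filter_upwards [_root_.LocallyIntegrable.ae_hasDerivAt_integral hl] with t ht
  exact (ht 0).const_add x₀

/-- One-sidedness can be applied only at the nodal values `p`, `q` where `g` is evaluated. Replacing
the arcs by them costs `O(h + k)`, paired with a bounded velocity difference, so Gronwall bounds the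
squared distance by `O(h + k)`. -/
theorem exists_norm_eulerPrimitive_sub_sq_le [FiniteDimensional ℝ E] {A : E →L[ℝ] E}
    (hA : ∀ x y, inner ℝ (A x) y = inner ℝ x (A y)) {c K : ℝ} (hc : 0 < c)
    (hcA : ∀ x, c * ‖x‖ ^ 2 ≤ inner ℝ (A x) x) (hK : 0 ≤ K)
    (hg : ∀ x, ‖g x‖ ≤ L * (1 + ‖x‖))
    (hgA : ∀ x y, inner ℝ (A (x - y)) (g x - g y) ≤ K * ‖x - y‖ ^ 2)
    (hΓ : LipschitzWith L Γ) (hΓ0 : Γ 0 = 0) (x₀ : E) (T : ℝ) :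
    ∃ Q : ℝ, 0 ≤ Q ∧ ∀ h k : ℝ, 0 < h → h ≤ 1 → 0 < k → k ≤ 1 → ∀ t ∈ Icc 0 T,
      ‖eulerPrimitive g Γ x₀ h t - eulerPrimitive g Γ x₀ k t‖ ^ 2 ≤ Q * (h + k) := by
  set N : ℝ := L * (2 + eulerBound L x₀ T) with hN
  have hB := eulerBound_nonneg L x₀ T
  have hN0 : 0 ≤ N := by positivity
  -- The Gronwall bound with rate `2 * K` (from `d4`) and defect `D` collecting `d4` and `i1`; `|T|`
  -- keeps it nonnegative for every real `T`.
  refine ⟨(2 * (4 * K * N ^ 2 + 2 * N ^ 2 * ‖A‖) * |T|) * Real.exp (2 * (2 * K) / c * |T|) / c,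
    by positivity, ?_⟩
  intro h k hh hh1 hk hk1 t ht
  have htT : t ≤ |T| := ht.2.trans (le_abs_self T)
  set Z : ℝ → E := fun t => eulerPrimitive g Γ x₀ h t - eulerPrimitive g Γ x₀ k t with hZ
  have hD : 0 ≤ (4 * K * N ^ 2 + 2 * N ^ 2 * ‖A‖) * (h + k) := by positivity
  have hsub : uIcc 0 t ⊆ Icc 0 T := by
    rw [uIcc_of_le ht.1]; exact Icc_subset_Icc_right ht.2
  have hac : AbsolutelyContinuousOnInterval Z 0 t :=
    (((lipschitzOnWith_eulerPrimitive hg hΓ hh).mono hsub).absolutelyContinuousOnInterval).fun_sub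
      (((lipschitzOnWith_eulerPrimitive hg hΓ hk).mono hsub).absolutelyContinuousOnInterval)
  have key := hac.inner_map_self_le_gronwall hA hc hcA (K := 2 * K) (by positivity) hD ht.1
    (Z' := fun τ => g (eulerStep g Γ x₀ h τ) - g (eulerStep g Γ x₀ k τ)) ?_
  · have hZ0 : Z 0 = 0 := by simp [hZ, eulerPrimitive]
    rw [hZ0, map_zero, inner_zero_left, zero_add] at key
    rw [div_mul_eq_mul_div, le_div_iff₀ hc, mul_comm _ c]
    refine key.trans ?_
    calc _ ≤ 2 * ((4 * K * N ^ 2 + 2 * N ^ 2 * ‖A‖) * (h + k)) * |T| *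
          Real.exp (2 * (2 * K) / c * |T|) := by gcongr
      _ = _ := by ring
  · filter_upwards [ae_hasDerivAt_eulerPrimitive (g := g) (Γ := Γ) (x₀ := x₀) hh,
      ae_hasDerivAt_eulerPrimitive (g := g) (Γ := Γ) (x₀ := x₀) hk] with τ h1 h2 hτ
    refine ⟨h1.sub h2, ?_⟩
    have hτT : τ ∈ Icc 0 T := ⟨hτ.1.le, hτ.2.trans ht.2⟩
    have d1 := dist_eulerPrimitive_eulerStep_le (x₀ := x₀) hg hΓ hΓ0 hh hτT
    have d2 := dist_eulerPrimitive_eulerStep_le (x₀ := x₀) hg hΓ hΓ0 hk hτT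
    have n1 := norm_apply_eulerStep_le (x₀ := x₀) hg hΓ hh hτT
    have n2 := norm_apply_eulerStep_le (x₀ := x₀) hg hΓ hk hτT
    rw [← hN] at d1 d2
    set X := eulerPrimitive g Γ x₀ h τ
    set Y := eulerPrimitive g Γ x₀ k τ
    set p := eulerStep g Γ x₀ h τ
    set q := eulerStep g Γ x₀ k τ
    have hZτ : Z τ = X - Y := rfl
    have n3 : ‖g p - g q‖ ≤ 2 * N := by
      have : L * (1 + eulerBound L x₀ T) ≤ N := by rw [hN]; gcongr; norm_num
      linarith [norm_sub_le (g p) (g q)]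
    -- Both arcs carry the same `Γ τ`, which cancels.
    have d3 : ‖(X - Y) - (p - q)‖ ≤ N * (h + k) := by
      have : (X - Y) - (p - q) = (X + Γ τ - p) - (Y + Γ τ - q) := by abel
      rw [this]
      linarith [norm_sub_le (X + Γ τ - p) (Y + Γ τ - q)]
    have d4 : ‖p - q‖ ^ 2 ≤ 2 * ‖X - Y‖ ^ 2 + 4 * N ^ 2 * (h + k) := by
      have e1 : ‖p - q‖ ≤ ‖X - Y‖ + N * (h + k) := by
        have := norm_sub_le (X - Y) ((X - Y) - (p - q))
        rw [sub_sub_cancel] at this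
        linarith
      have e2 : (h + k) ^ 2 ≤ 2 * (h + k) := by nlinarith
      calc ‖p - q‖ ^ 2 ≤ (‖X - Y‖ + N * (h + k)) ^ 2 := by gcongr
        _ ≤ 2 * ‖X - Y‖ ^ 2 + 2 * N ^ 2 * (h + k) ^ 2 := by
          nlinarith [sq_nonneg (‖X - Y‖ - N * (h + k))]
        _ ≤ 2 * ‖X - Y‖ ^ 2 + 2 * N ^ 2 * (2 * (h + k)) := by gcongr
        _ = _ := by ring
    have i1 : inner ℝ (A ((X - Y) - (p - q))) (g p - g q) ≤ 2 * N ^ 2 * ‖A‖ * (h + k) := by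
      refine (real_inner_le_norm _ _).trans ?_
      calc _ ≤ (‖A‖ * (N * (h + k))) * (2 * N) := by
            gcongr
            exact (A.le_opNorm _).trans (by gcongr)
        _ = _ := by ring
    have i2 : inner ℝ (A (X - Y)) (g p - g q) =
        inner ℝ (A (p - q)) (g p - g q) + inner ℝ (A ((X - Y) - (p - q))) (g p - g q) := by
      rw [← inner_add_left, ← map_add]; congr 2; abel
    have i3 := mul_le_mul_of_nonneg_left d4 hK
    have i4 := hgA p q
    rw [hZτ, i2]
    linarith

end EulerPolygon

/-! ### Passage to the limit in the differential inclusion -/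

section Inclusion

open Filter Topology

variable {E : Type*} [NormedAddCommGroup E] [InnerProductSpace ℝ E]

/-- The difference quotient is the mean of the velocities, and a closed convex set contains the
means of its elements. -/
theorem slope_eulerPrimitive_mem [FiniteDimensional ℝ E] {g : E → E} {Γ : ℝ → E} {x₀ : E}
    {h s t : ℝ} (hh : 0 < h) (hst : s < t) {C : Set E} (hC : Convex ℝ C) (hCc : IsClosed C)
    (hgC : ∀ τ ∈ Icc s t, g (eulerStep g Γ x₀ h τ) ∈ C) :
    (t - s)⁻¹ • (eulerPrimitive g Γ x₀ h t - eulerPrimitive g Γ x₀ h s) ∈ C := by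
  have hc : CompleteSpace E := FiniteDimensional.complete ℝ E
  have h1 := hC.set_average_mem hCc (μ := volume) (t := Ioc s t)
    (f := fun τ => g (eulerStep g Γ x₀ h τ)) (by simp [hst]) (by simp)
    ((ae_restrict_iff' measurableSet_Ioc).2 (.of_forall fun τ hτ => hgC τ (Ioc_subset_Icc_self hτ)))
    ((intervalIntegrable_iff_integrableOn_Ioc_of_le hst.le).1 (intervalIntegrable_eulerStep hh _ _))
  rwa [setAverage_eq, measureReal_def, Real.volume_Ioc, ENNReal.toReal_ofReal (by linarith),
    ← intervalIntegral.integral_of_le hst.le, ← eulerPrimitive_sub hh] at h1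

theorem exists_lipschitz_arc_deriv_mem [FiniteDimensional ℝ E] {G : E → Set E} {A : E →L[ℝ] E}
    (hA : ∀ x y, inner ℝ (A x) y = inner ℝ x (A y)) {c K : ℝ} (hc : 0 < c)
    (hcA : ∀ x, c * ‖x‖ ^ 2 ≤ inner ℝ (A x) x) (hK : 0 ≤ K) {L : NNReal}
    (hGne : ∀ x, (G x).Nonempty) (hGconv : ∀ x, Convex ℝ (G x)) (hGclosed : ∀ x, IsClosed (G x))
    (hGbd : ∀ x, ∀ v ∈ G x, ‖v‖ ≤ L * (1 + ‖x‖))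
    (hGA : ∀ x y, ∀ v ∈ G x, ∀ w ∈ G y, inner ℝ (A (x - y)) (v - w) ≤ K * ‖x - y‖ ^ 2)
    (hGusc : ∀ x, ∀ ε > 0, ∀ᶠ y in 𝓝 x, G y ⊆ Metric.cthickening ε (G x))
    {Γ : ℝ → E} (hΓ : LipschitzWith L Γ) (hΓ0 : Γ 0 = 0) (x₀ : E) :
    ∃ y : ℝ → E, y 0 = x₀ ∧ (∀ T, ∃ M : NNReal, LipschitzOnWith M y (Icc 0 T)) ∧
      ∀ t > 0, ∀ v, HasDerivAt y v t → v ∈ G (y t + Γ t) := by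
  have hcs : CompleteSpace E := FiniteDimensional.complete ℝ E
  choose g hgG using hGne
  have hg : ∀ x, ‖g x‖ ≤ L * (1 + ‖x‖) := fun x => hGbd x _ (hgG x)
  set η : ℕ → ℝ := fun k => 1 / ((k : ℝ) + 1) with hη
  have hη0 : ∀ k, 0 < η k := fun k => Nat.one_div_pos_of_nat
  have hη1 : ∀ k, η k ≤ 1 := fun k => by
    rw [hη]; simp only; rw [div_le_one (by positivity)]; linarith [k.cast_nonneg (α := ℝ)]
  have hηt : Tendsto η atTop (𝓝 0) := tendsto_one_div_add_atTop_nhds_zero_nat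
  set p : ℕ → ℝ → E := fun k t => eulerPrimitive g Γ x₀ (η k) t with hp
  have hcauchy : ∀ T, ∃ Q : ℝ, 0 ≤ Q ∧ ∀ k l, ∀ t ∈ Icc 0 T,
      ‖p k t - p l t‖ ^ 2 ≤ Q * (η k + η l) := fun T => by
    obtain ⟨Q, hQ, h⟩ := exists_norm_eulerPrimitive_sub_sq_le hA hc hcA hK hg
      (fun x y => hGA x y _ (hgG x) _ (hgG y)) hΓ hΓ0 x₀ T
    exact ⟨Q, hQ, fun k l => h _ _ (hη0 k) (hη1 k) (hη0 l) (hη1 l)⟩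
  have hlim : ∀ t : ℝ, ∃ y : E, 0 ≤ t → Tendsto (fun k => p k t) atTop (𝓝 y) := by
    intro t
    by_cases ht : 0 ≤ t
    · obtain ⟨Q, hQ, h⟩ := hcauchy t
      have hcs : CauchySeq (fun k => p k t) := by
        refine cauchySeq_of_le_tendsto_0 (fun k => √(Q * (η k + η k))) (fun n m N hn hm => ?_) ?_
        · rw [dist_eq_norm]
          refine Real.le_sqrt_of_sq_le ((h n m t ⟨ht, le_rfl⟩).trans ?_)
          have e1 : η n ≤ η N := Nat.one_div_le_one_div hn
          have e2 : η m ≤ η N := Nat.one_div_le_one_div hm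
          gcongr
        · have := ((hηt.add hηt).const_mul Q).sqrt
          simpa using this
      obtain ⟨y, hy⟩ := cauchySeq_tendsto_of_complete hcs
      exact ⟨y, fun _ => hy⟩
    · exact ⟨0, fun h => absurd h ht⟩
  choose y hy using hlim
  have hylip : ∀ T, ∃ M : NNReal, LipschitzOnWith M y (Icc 0 T) := fun T => by
    refine ⟨Real.toNNReal (L * (1 + eulerBound L x₀ T)), LipschitzOnWith.of_dist_le_mul
      fun s hs t ht => le_of_tendsto ((hy s hs.1).dist (hy t ht.1)) (.of_forall fun k => ?_)⟩
    exact (lipschitzOnWith_eulerPrimitive hg hΓ (hη0 k)).dist_le_mul s hs t ht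
  refine ⟨y, tendsto_nhds_unique (hy 0 le_rfl) (by simp [hp, eulerPrimitive]), hylip, ?_⟩
  intro t ht v hv
  set z := y t + Γ t with hz
  -- Near `t` the Euler values lie within `δ` of `z`, so their velocities lie in the convex
  -- `ε`-thickening of `G z`. Slopes inherit this as `k → ∞`, then as `s ↓ t`.
  have hmem : ∀ ε > 0, v ∈ Metric.cthickening ε (G z) := by
    intro ε hε
    obtain ⟨δ, hδ, hball⟩ := Metric.eventually_nhds_iff.1 (hGusc z ε hε)
    obtain ⟨Q, hQ, hQle⟩ := hcauchy (t + 1)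
    set N : ℝ := L * (2 + eulerBound L x₀ (t + 1)) with hN
    have hsmall : ∀ᶠ k in atTop, N * η k + √(Q * η k) < δ / 2 := by
      have h1 := (hηt.const_mul N).add (hηt.const_mul Q).sqrt
      simp only [mul_zero, Real.sqrt_zero, add_zero] at h1
      exact h1.eventually (gt_mem_nhds (half_pos hδ))
    have hcont : ∀ᶠ s in 𝓝 t, dist (y s + Γ s) z < δ / 2 :=
      (hv.continuousAt.add hΓ.continuous.continuousAt) (Metric.ball_mem_nhds _ (half_pos hδ))
    obtain ⟨r, hr, hrs⟩ := Metric.eventually_nhds_iff.1 hcont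
    have hslope : Tendsto (fun s => (s - t)⁻¹ • (y s - y t)) (𝓝[>] t) (𝓝 v) := by
      have := hv.tendsto_slope.mono_left (nhdsWithin_mono t fun s (hs : t < s) => ne_of_gt hs)
      exact this
    refine Metric.isClosed_cthickening.mem_of_tendsto hslope ?_
    filter_upwards [Ioo_mem_nhdsGT (show t < t + min r 1 by
      linarith [lt_min hr one_pos])] with s hs
    have hs1 : s < t + 1 := hs.2.trans_le (by linarith [min_le_right r 1])
    have hsr : s < t + r := hs.2.trans_le (by linarith [min_le_left r 1])
    refine Metric.isClosed_cthickening.mem_of_tendsto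
      (((hy s (ht.le.trans hs.1.le)).sub (hy t ht.le)).const_smul (s - t)⁻¹) ?_
    filter_upwards [hsmall] with k hk
    refine slope_eulerPrimitive_mem (hη0 k) hs.1 ((hGconv z).cthickening ε)
      Metric.isClosed_cthickening fun τ hτ => ?_
    refine hball ?_ (hgG _)
    have hτT : τ ∈ Icc 0 (t + 1) := ⟨ht.le.trans hτ.1, hτ.2.trans hs1.le⟩
    have d1 : ‖p k τ + Γ τ - eulerStep g Γ x₀ (η k) τ‖ ≤ N * η k :=
      dist_eulerPrimitive_eulerStep_le hg hΓ hΓ0 (hη0 k) hτT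
    -- Obtained from the Cauchy estimate by letting the second index tend to infinity.
    have d2 : ‖p k τ - y τ‖ ≤ √(Q * η k) := by
      refine Real.le_sqrt_of_sq_le ?_
      have h1 : Tendsto (fun l => Q * (η k + η l)) atTop (𝓝 (Q * (η k + 0))) :=
        (hηt.const_add _).const_mul Q
      rw [add_zero] at h1
      exact le_of_tendsto_of_tendsto' ((tendsto_const_nhds.sub (hy τ hτT.1)).norm.pow 2) h1
        fun l => hQle k l τ hτT
    have d3 : dist (y τ + Γ τ) z < δ / 2 := by
      apply hrs
      rw [Real.dist_eq, abs_of_nonneg (by linarith [hτ.1])]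
      linarith [hτ.2]
    rw [dist_eq_norm] at d3 ⊢
    have e : eulerStep g Γ x₀ (η k) τ - z = (p k τ - y τ) -
        (p k τ + Γ τ - eulerStep g Γ x₀ (η k) τ) + (y τ + Γ τ - z) := by abel
    rw [e]
    refine (norm_add_le _ _).trans_lt ?_
    linarith [norm_sub_le (p k τ - y τ) (p k τ + Γ τ - eulerStep g Γ x₀ (η k) τ)]
  rw [← (hGclosed z).closure_eq, Metric.closure_eq_iInter_cthickening]
  simpa using hmem

end Inclusion

/-! ### The multivalued sign and the field built from it -/

section MultivaluedSign

open Filter Topology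

theorem multiSgn_of_pos {r : ℝ} (h : 0 < r) : multiSgn r = {1} := by
  ext s; simp [multiSgn, h, h.ne', h.le]

theorem multiSgn_of_neg {r : ℝ} (h : r < 0) : multiSgn r = {-1} := by
  ext s; simp [multiSgn, h, h.ne, h.le]

theorem multiSgn_zero : multiSgn 0 = Icc (-1) 1 := by
  ext s; simp [multiSgn]

theorem multiSgn_subset_Icc (r : ℝ) : multiSgn r ⊆ Icc (-1) 1 := by
  rcases lt_trichotomy r 0 with h | rfl | h
  · simp [multiSgn_of_neg h]
  · simp [multiSgn_zero]
  · simp [multiSgn_of_pos h]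

theorem abs_le_one_of_mem_multiSgn {r s : ℝ} (h : s ∈ multiSgn r) : |s| ≤ 1 :=
  abs_le.2 (multiSgn_subset_Icc r h)

theorem multiSgn_nonempty (r : ℝ) : (multiSgn r).Nonempty := by
  rcases lt_trichotomy r 0 with h | rfl | h
  · simp [multiSgn_of_neg h]
  · simp [multiSgn_zero]
  · simp [multiSgn_of_pos h]

theorem convex_multiSgn (r : ℝ) : Convex ℝ (multiSgn r) := by
  rcases lt_trichotomy r 0 with h | rfl | h
  · rw [multiSgn_of_neg h]; exact convex_singleton _
  · rw [multiSgn_zero]; exact convex_Icc _ _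
  · rw [multiSgn_of_pos h]; exact convex_singleton _

theorem isCompact_multiSgn (r : ℝ) : IsCompact (multiSgn r) := by
  rcases lt_trichotomy r 0 with h | rfl | h
  · rw [multiSgn_of_neg h]; exact isCompact_singleton
  · rw [multiSgn_zero]; exact isCompact_Icc
  · rw [multiSgn_of_pos h]; exact isCompact_singleton

theorem mul_eq_abs_of_mem_multiSgn {r s : ℝ} (h : s ∈ multiSgn r) : s * r = |r| := by
  rcases lt_trichotomy r 0 with h0 | rfl | h0
  · rw [h.2.1 h0, abs_of_neg h0]; ring
  · simp
  · rw [h.1 h0, abs_of_pos h0]; ring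

theorem multiSgn_monotone {a b s t : ℝ} (hs : s ∈ multiSgn a) (ht : t ∈ multiSgn b) :
    0 ≤ (s - t) * (a - b) := by
  have h1 := mul_eq_abs_of_mem_multiSgn hs
  have h2 := mul_eq_abs_of_mem_multiSgn ht
  have h3 : s * b ≤ |b| := (le_abs_self _).trans (by
    rw [abs_mul]; exact mul_le_of_le_one_left (abs_nonneg _) (abs_le_one_of_mem_multiSgn hs))
  have h4 : t * a ≤ |a| := (le_abs_self _).trans (by
    rw [abs_mul]; exact mul_le_of_le_one_left (abs_nonneg _) (abs_le_one_of_mem_multiSgn ht))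
  calc (0 : ℝ) ≤ (s * a - t * a) + (t * b - s * b) := by linarith
    _ = _ := by ring

/-- Upper semicontinuity without any thickening; for `signField`, the `ε` is then needed only for
the variation of `f`. -/
theorem eventually_multiSgn_subset (r : ℝ) : ∀ᶠ q in 𝓝 r, multiSgn q ⊆ multiSgn r := by
  rcases lt_trichotomy r 0 with h | rfl | h
  · filter_upwards [gt_mem_nhds h] with q hq
    rw [multiSgn_of_neg h, multiSgn_of_neg hq]
  · exact .of_forall fun q => by rw [multiSgn_zero]; exact multiSgn_subset_Icc q
  · filter_upwards [lt_mem_nhds h] with q hq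
    rw [multiSgn_of_pos h, multiSgn_of_pos hq]

variable {E : Type*} [NormedAddCommGroup E] [InnerProductSpace ℝ E] {m : ℕ}

/-- The autonomous multivalued field `f(x) - ∑ ρ i • b i • sgn ⟪A x, b i⟫`. -/
def signField (f : E → E) (A : E →L[ℝ] E) (b : Fin m → E) (ρ : Fin m → ℝ) (x : E) : Set E :=
  {v | ∃ s : Fin m → ℝ, (∀ i, s i ∈ multiSgn (inner ℝ (A x) (b i))) ∧
    v = f x - ∑ i, (ρ i * s i) • b i}

variable {f : E → E} {A : E →L[ℝ] E} {b : Fin m → E} {ρ : Fin m → ℝ}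

theorem signField_nonempty (x : E) : (signField f A b ρ x).Nonempty := by
  choose s hs using fun i => multiSgn_nonempty (inner ℝ (A x) (b i))
  exact ⟨_, s, hs, rfl⟩

theorem convex_signField (x : E) : Convex ℝ (signField f A b ρ x) := by
  rintro v ⟨s, hs, rfl⟩ w ⟨t, ht, rfl⟩ α β hα hβ hαβ
  refine ⟨fun i => α * s i + β * t i, fun i => convex_multiSgn _ (hs i) (ht i) hα hβ hαβ, ?_⟩
  have h1 : ∑ i, (ρ i * (α * s i + β * t i)) • b i =
      α • ∑ i, (ρ i * s i) • b i + β • ∑ i, (ρ i * t i) • b i := by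
    rw [Finset.smul_sum, Finset.smul_sum, ← Finset.sum_add_distrib]
    exact Finset.sum_congr rfl fun i _ => by rw [smul_smul, smul_smul, ← add_smul]; ring_nf
  have h2 : f x = α • f x + β • f x := by rw [← add_smul, hαβ, one_smul]
  rw [h1, smul_sub, smul_sub]
  nth_rewrite 3 [h2]
  abel

theorem isClosed_signField (x : E) : IsClosed (signField f A b ρ x) := by
  have h : signField f A b ρ x = (fun s : Fin m → ℝ => f x - ∑ i, (ρ i * s i) • b i) ''
      univ.pi fun i => multiSgn (inner ℝ (A x) (b i)) := by
    ext v
    simp only [signField, mem_ofPred_eq, mem_image, mem_univ_pi, eq_comm]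
  rw [h]
  exact ((isCompact_univ_pi fun i => isCompact_multiSgn _).image (by fun_prop)).isClosed

theorem norm_le_of_mem_signField {x v : E} (hv : v ∈ signField f A b ρ x) :
    ‖v‖ ≤ ‖f x‖ + ∑ i, |ρ i| * ‖b i‖ := by
  obtain ⟨s, hs, rfl⟩ := hv
  refine (norm_sub_le _ _).trans (add_le_add le_rfl (norm_sum_le_of_le _ fun i _ => ?_))
  rw [norm_smul, Real.norm_eq_abs, abs_mul]
  gcongr
  exact mul_le_of_le_one_right (abs_nonneg _) (abs_le_one_of_mem_multiSgn (hs i))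

/-- The same `A` occurs in the switching argument and in the inner product, so the sign terms
contribute monotone products of the favourable sign; only `f` remains. -/
theorem inner_signField_sub_le {L : NNReal} (hf : LipschitzWith L f) (hρ : ∀ i, 0 ≤ ρ i)
    {x y v w : E} (hv : v ∈ signField f A b ρ x) (hw : w ∈ signField f A b ρ y) :
    inner ℝ (A (x - y)) (v - w) ≤ ‖A‖ * L * ‖x - y‖ ^ 2 := by
  obtain ⟨s, hs, rfl⟩ := hv
  obtain ⟨t, ht, rfl⟩ := hw
  have h1 : inner ℝ (A (x - y)) (∑ i, (ρ i * s i) • b i - ∑ i, (ρ i * t i) • b i) =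
      ∑ i, ρ i * ((s i - t i) * (inner ℝ (A x) (b i) - inner ℝ (A y) (b i))) := by
    rw [← Finset.sum_sub_distrib, inner_sum]
    refine Finset.sum_congr rfl fun i _ => ?_
    rw [← sub_smul, inner_smul_right, map_sub, inner_sub_left]
    ring
  have h2 : 0 ≤ ∑ i, ρ i * ((s i - t i) * (inner ℝ (A x) (b i) - inner ℝ (A y) (b i))) :=
    Finset.sum_nonneg fun i _ => mul_nonneg (hρ i) (multiSgn_monotone (hs i) (ht i))
  have h3 : inner ℝ (A (x - y)) (f x - f y) ≤ ‖A‖ * L * ‖x - y‖ ^ 2 := by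
    refine (real_inner_le_norm _ _).trans ?_
    calc _ ≤ (‖A‖ * ‖x - y‖) * (L * ‖x - y‖) := by
          gcongr
          · exact A.le_opNorm _
          · exact hf.norm_sub_le x y
      _ = _ := by ring
  have h4 : (f x - ∑ i, (ρ i * s i) • b i) - (f y - ∑ i, (ρ i * t i) • b i) =
      (f x - f y) - (∑ i, (ρ i * s i) • b i - ∑ i, (ρ i * t i) • b i) := by abel
  rw [h4, inner_sub_right, h1]
  linarith

theorem eventually_signField_subset (hf : Continuous f) (x : E) {ε : ℝ} (hε : 0 < ε) :
    ∀ᶠ y in 𝓝 x, signField f A b ρ y ⊆ Metric.cthickening ε (signField f A b ρ x) := by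
  have h1 : ∀ᶠ y in 𝓝 x, ∀ i, multiSgn (inner ℝ (A y) (b i)) ⊆ multiSgn (inner ℝ (A x) (b i)) := by
    refine eventually_all.2 fun i => ?_
    have hc : Continuous fun y => inner ℝ (A y) (b i) := by fun_prop
    exact hc.continuousAt.eventually (eventually_multiSgn_subset _)
  filter_upwards [h1, hf.continuousAt (Metric.closedBall_mem_nhds (f x) hε)] with y hy hfy
  rintro v ⟨s, hs, rfl⟩
  refine Metric.mem_cthickening_of_dist_le _ (f x - ∑ i, (ρ i * s i) • b i) _ _
    ⟨s, fun i => hy i (hs i), rfl⟩ ?_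
  rw [dist_sub_right]
  exact hfy

/-- With `r = ⟪A x, b i⟫`, the control dissipates `ρ i * |r|`, which dominates the disturbance power
`γ i * r`. -/
theorem inner_add_sum_smul_nonpos_of_mem_signField {γ : Fin m → ℝ} (hγ : ∀ i, |γ i| ≤ ρ i) {x v : E}
    (hf : inner ℝ (A x) (f x) ≤ 0) (hv : v ∈ signField f A b ρ x) :
    inner ℝ (A x) (v + ∑ i, γ i • b i) ≤ 0 := by
  obtain ⟨s, hs, rfl⟩ := hv
  have h : ∑ i, γ i * inner ℝ (A x) (b i) ≤ ∑ i, ρ i * s i * inner ℝ (A x) (b i) := by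
    refine Finset.sum_le_sum fun i _ => ?_
    rw [mul_assoc, mul_eq_abs_of_mem_multiSgn (hs i)]
    refine (le_abs_self _).trans ?_
    rw [abs_mul]
    gcongr
    exact hγ i
  simp only [inner_add_right, inner_sub_right, inner_sum, inner_smul_right]
  linarith

end MultivaluedSign

/-! ### The inner product defined by `P` and the gradient of `V` -/

section PositiveDefinite

theorem Matrix.PosDef.inner_toEuclideanCLM_comm {n : ℕ} {P : Matrix (Fin n) (Fin n) ℝ}
    (hP : P.PosDef) (x y : EuclideanSpace ℝ (Fin n)) :
    inner ℝ (Matrix.toEuclideanCLM (𝕜 := ℝ) P x) y =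
      inner ℝ x (Matrix.toEuclideanCLM (𝕜 := ℝ) P y) := by
  have h : ContinuousLinearMap.adjoint (Matrix.toEuclideanCLM (𝕜 := ℝ) P) =
      Matrix.toEuclideanCLM (𝕜 := ℝ) P := by
    rw [← ContinuousLinearMap.star_eq_adjoint, ← map_star, Matrix.star_eq_conjTranspose,
      hP.isHermitian.eq]
  rw [← ContinuousLinearMap.adjoint_inner_right, h]

theorem Matrix.PosDef.inner_toEuclideanCLM_pos {n : ℕ} {P : Matrix (Fin n) (Fin n) ℝ}
    (hP : P.PosDef) {x : EuclideanSpace ℝ (Fin n)} (hx : x ≠ 0) :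
    0 < inner ℝ (Matrix.toEuclideanCLM (𝕜 := ℝ) P x) x := by
  rw [real_inner_comm, Matrix.inner_toEuclideanCLM]
  have := hP.dotProduct_mulVec_pos (x := x.ofLp) (by simpa using hx)
  simpa using this

theorem exists_pos_mul_sq_norm_le_inner {E : Type*} [NormedAddCommGroup E] [InnerProductSpace ℝ E]
    [FiniteDimensional ℝ E] {A : E →L[ℝ] E} (hA : ∀ x ≠ 0, 0 < inner ℝ (A x) x) :
    ∃ c > 0, ∀ x, c * ‖x‖ ^ 2 ≤ inner ℝ (A x) x := by
  have hprop : ProperSpace E := FiniteDimensional.proper_real E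
  -- The unit sphere is empty exactly when the space is trivial; otherwise `c` is the minimum of the
  -- form on it.
  rcases (Metric.sphere (0 : E) 1).eq_empty_or_nonempty with h | h
  · refine ⟨1, one_pos, fun x => ?_⟩
    have hx : x = 0 := by
      by_contra hx
      have : ‖x‖⁻¹ • x ∈ Metric.sphere (0 : E) 1 := by simp [norm_smul, hx]
      rw [h] at this
      exact this
    simp [hx]
  · obtain ⟨z, hz, hmin⟩ := (isCompact_sphere (0 : E) 1).exists_isMinOn h
      (f := fun x => inner ℝ (A x) x) (by fun_prop)
    refine ⟨inner ℝ (A z) z, hA z (by rintro rfl; simp at hz), fun x => ?_⟩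
    rcases eq_or_ne x 0 with rfl | hx
    · simp
    · have h1 : ‖x‖⁻¹ • x ∈ Metric.sphere (0 : E) 1 := by simp [norm_smul, hx]
      have h2 := hmin h1
      simp only [mem_ofPred_eq, map_smul, inner_smul_left, inner_smul_right] at h2
      have h3 := mul_le_mul_of_nonneg_right h2 (sq_nonneg ‖x‖)
      have h4 : ‖x‖ ≠ 0 := norm_ne_zero_iff.2 hx
      refine h3.trans_eq ?_
      simp only [conj_trivial]
      field_simp

theorem gradient_quadV {n : ℕ} {P : Matrix (Fin n) (Fin n) ℝ} (hP : P.PosDef)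
    (x : EuclideanSpace ℝ (Fin n)) :
    gradient (quadV P) x = Matrix.toEuclideanCLM (𝕜 := ℝ) P x := by
  set A := Matrix.toEuclideanCLM (𝕜 := ℝ) P with hA
  have h : quadV P = fun x => (1 / 2) * inner ℝ (A x) x := by
    ext x
    rw [quadV, real_inner_comm, hA, Matrix.inner_toEuclideanCLM]
  refine HasGradientAt.gradient ?_
  rw [hasGradientAt_iff_hasFDerivAt, h]
  have h1 := ((A.hasFDerivAt (x := x)).inner ℝ (hasFDerivAt_id x)).const_mul (1 / 2)
  refine h1.congr_fderiv ?_
  ext y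
  simp only [one_div, smul_apply, ContinuousLinearMap.comp_apply,
    ContinuousLinearMap.prod_apply, fderivInnerCLM_apply, smul_eq_mul,
    InnerProductSpace.toDual_apply_apply]
  rw [hP.inner_toEuclideanCLM_comm y, ← hA, real_inner_comm y (A x)]
  simp only [ContinuousLinearMap.id_apply, id]
  rw [real_inner_comm y (A x)]
  ring

end PositiveDefinite

/-! ### Uniqueness, global Lipschitz bound, and assembly -/

section Solutions

variable {n : ℕ} {F : ℝ → EuclideanSpace ℝ (Fin n) → Set (EuclideanSpace ℝ (Fin n))}
  {x₀ : EuclideanSpace ℝ (Fin n)} {x y : ℝ → EuclideanSpace ℝ (Fin n)}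
  {A : EuclideanSpace ℝ (Fin n) →L[ℝ] EuclideanSpace ℝ (Fin n)} {c K : ℝ}

theorem IsSolution.ae_deriv (hx : IsSolution F x₀ x) :
    ∀ᵐ t, 0 < t → HasDerivAt x (deriv x t) t ∧ deriv x t ∈ F t (x t) := by
  filter_upwards [(ae_restrict_iff' measurableSet_Ioi).1 hx.incl] with t ht h0
  obtain ⟨v, hv, hd⟩ := ht h0
  rw [hd.deriv]
  exact ⟨hd, hv⟩

theorem IsSolution.eqOn (hA : ∀ x y, inner ℝ (A x) y = inner ℝ x (A y)) (hc : 0 < c)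
    (hcA : ∀ x, c * ‖x‖ ^ 2 ≤ inner ℝ (A x) x) (hK : 0 ≤ K)
    (hFA : ∀ t > 0, ∀ x y, ∀ v ∈ F t x, ∀ w ∈ F t y,
      inner ℝ (A (x - y)) (v - w) ≤ K * ‖x - y‖ ^ 2)
    (hx : IsSolution F x₀ x) (hy : IsSolution F x₀ y) : EqOn x y (Ici 0) := by
  intro t ht
  have key := ((hx.absCont t ht).fun_sub (hy.absCont t ht)).inner_map_self_le_gronwall hA hc hcA hK
    le_rfl ht (Z' := fun t => deriv x t - deriv y t) (by
      filter_upwards [hx.ae_deriv, hy.ae_deriv] with s h1 h2 hs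
      refine ⟨(h1 hs.1).1.sub (h2 hs.1).1, ?_⟩
      rw [add_zero]
      exact hFA s hs.1 _ _ _ (h1 hs.1).2 _ (h2 hs.1).2)
  rw [hx.init, hy.init, sub_self, map_zero, inner_zero_left, mul_zero, zero_mul, add_zero,
    zero_mul] at key
  have h : ‖x t - y t‖ ^ 2 ≤ 0 := nonpos_of_mul_nonpos_right key hc
  rw [← sub_eq_zero, ← norm_eq_zero]
  exact pow_eq_zero_iff two_ne_zero |>.1 (le_antisymm h (sq_nonneg _))

theorem IsSolution.exists_lipschitzOnWith_Ici
    (hA : ∀ x y, inner ℝ (A x) y = inner ℝ x (A y)) (hc : 0 < c)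
    (hcA : ∀ x, c * ‖x‖ ^ 2 ≤ inner ℝ (A x) x) {L : NNReal}
    (hFbd : ∀ t > 0, ∀ x, ∀ v ∈ F t x, ‖v‖ ≤ L * (1 + ‖x‖))
    (hFA : ∀ t > 0, ∀ x, ∀ v ∈ F t x, inner ℝ (A x) v ≤ 0)
    (hx : IsSolution F x₀ x) : ∃ M : NNReal, LipschitzOnWith M x (Ici 0) := by
  -- Radius of a ball containing the initial sublevel set of `V`.
  set R : ℝ := √(inner ℝ (A x₀) x₀ / c) with hR
  have hbd : ∀ t, 0 ≤ t → ‖x t‖ ≤ R := fun t ht => by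
    have key := (hx.absCont t ht).inner_map_self_le_gronwall hA hc hcA le_rfl le_rfl ht
      (Z' := deriv x) (by
        filter_upwards [hx.ae_deriv] with s h1 hs
        refine ⟨(h1 hs.1).1, ?_⟩
        simpa using hFA s hs.1 _ _ (h1 hs.1).2)
    refine Real.le_sqrt_of_sq_le ?_
    rw [le_div_iff₀ hc, mul_comm]
    simpa [hx.init] using key
  have hlip : ∀ s t, 0 ≤ s → s ≤ t → dist (x s) (x t) ≤ L * (1 + R) * (t - s) := by
    intro s t hs hst
    refine AbsolutelyContinuousOnInterval.dist_le_of_ae_hasDerivAt (x' := deriv x) hst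
      ((hx.absCont t (hs.trans hst)).mono ?_) ?_
    · rw [uIcc_of_le hst, uIcc_of_le (hs.trans hst)]
      exact Icc_subset_Icc_left hs
    · filter_upwards [hx.ae_deriv] with τ h1 hτ
      have hτ0 : 0 < τ := hs.trans_lt hτ.1
      refine ⟨(h1 hτ0).1, (hFbd τ hτ0 _ _ (h1 hτ0).2).trans ?_⟩
      gcongr
      exact hbd τ hτ0.le
  refine ⟨Real.toNNReal (L * (1 + R)), LipschitzOnWith.of_dist_le_mul fun s hs t ht => ?_⟩
  rw [Real.coe_toNNReal _ (by positivity)]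
  rcases le_total s t with h | h
  · rw [Real.dist_eq, abs_sub_comm, abs_of_nonneg (sub_nonneg.2 h)]
    exact hlip s t hs h
  · rw [Real.dist_eq, abs_of_nonneg (sub_nonneg.2 h), dist_comm]
    exact hlip t s ht h

theorem ae_hasDerivAt_of_lipschitzOnWith_Icc {E : Type*} [NormedAddCommGroup E] [NormedSpace ℝ E]
    [FiniteDimensional ℝ E] {y : ℝ → E}
    (hy : ∀ T, ∃ M : NNReal, LipschitzOnWith M y (Icc 0 T)) :
    ∀ᵐ t, 0 < t → HasDerivAt y (deriv y t) t := by
  have h : ∀ᵐ t, ∀ N : ℕ, t ∈ Icc (0 : ℝ) N → DifferentiableWithinAt ℝ y (Icc 0 N) t :=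
    ae_all_iff.2 fun N => by
      obtain ⟨M, hM⟩ := hy N
      exact hM.ae_differentiableWithinAt_of_mem_real
  filter_upwards [h] with t ht h0
  obtain ⟨N, hN⟩ := exists_nat_gt t
  exact ((ht N ⟨h0.le, hN.le⟩).differentiableAt (Icc_mem_nhds h0 hN)).hasDerivAt

theorem locallyIntegrable_of_norm_le {E : Type*} [NormedAddCommGroup E] {u : ℝ → E} {M : ℝ}
    (hu : AEStronglyMeasurable u volume) (hM : ∀ t, ‖u t‖ ≤ M) : LocallyIntegrable u volume :=
  fun t => ⟨Ioc (t - 1) (t + 1), Ioc_mem_nhds (by linarith) (by linarith),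
    Measure.integrableOn_of_bounded (by simp) hu (.of_forall hM)⟩

theorem lipschitzWith_integral_of_norm_le {E : Type*} [NormedAddCommGroup E] [NormedSpace ℝ E]
    {u : ℝ → E} {M : NNReal} (hu : AEStronglyMeasurable u volume) (hM : ∀ t, ‖u t‖ ≤ M) :
    LipschitzWith M (fun t => ∫ τ in (0 : ℝ)..t, u τ) := by
  have hi : ∀ a b, IntervalIntegrable u volume a b := fun a b =>
    intervalIntegrable_iff.2 (Measure.integrableOn_of_bounded (by simp [uIoc]) hu (.of_forall hM))
  refine LipschitzWith.of_dist_le_mul fun s t => ?_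
  rw [dist_eq_norm, intervalIntegral.integral_interval_sub_left (hi 0 s) (hi 0 t), Real.dist_eq]
  exact intervalIntegral.norm_integral_le_of_norm_le_const fun τ _ => hM τ

end Solutions

theorem mainTheorem4 (n m : ℕ)
    (f : EuclideanSpace ℝ (Fin n) → EuclideanSpace ℝ (Fin n))
    (hf : ∃ L : NNReal, LipschitzWith L f)
    (B : Matrix (Fin n) (Fin m) ℝ) (ρ : Fin m → ℝ) (γ : ℝ → Fin m → ℝ)
    (hγ_meas : ∀ i, AEMeasurable (fun t => γ t i) (volume.restrict (Ici (0 : ℝ))))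
    (hγ : ∀ i, ∀ t, 0 ≤ t → |γ t i| < ρ i)
    (P : Matrix (Fin n) (Fin n) ℝ) (hP : P.PosDef)
    (x₀ : EuclideanSpace ℝ (Fin n)) :
    ∃ x : ℝ → EuclideanSpace ℝ (Fin n),
      IsSolution (closedLoop f B ρ (quadV P) γ) x₀ x ∧
      (∀ T : ℝ, 0 ≤ T → ∃ K : NNReal, LipschitzOnWith K x (Icc 0 T)) ∧
      ((∀ z, inner ℝ (gradient (quadV P) z) (f z) ≤ 0) →
        ∃ K : NNReal, LipschitzOnWith K x (Ici 0)) ∧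
      ∀ y : ℝ → EuclideanSpace ℝ (Fin n),
        IsSolution (closedLoop f B ρ (quadV P) γ) x₀ y → EqOn y x (Ici 0) := by
  obtain ⟨Lf, hf⟩ := hf
  set A := Matrix.toEuclideanCLM (𝕜 := ℝ) P with hAdef
  have hA : ∀ x y, inner ℝ (A x) y = inner ℝ x (A y) := hP.inner_toEuclideanCLM_comm
  obtain ⟨c, hc, hcA⟩ := exists_pos_mul_sq_norm_le_inner (A := A)
    fun x hx => hP.inner_toEuclideanCLM_pos hx
  have hgrad : ∀ x, gradient (quadV P) x = A x := gradient_quadV hP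
  have hρ : ∀ i, 0 ≤ ρ i := fun i => (abs_nonneg _).trans (hγ i 0 le_rfl).le
  set G := signField f A (euclCol B) ρ with hG
  have hFG : ∀ t x v, v ∈ closedLoop f B ρ (quadV P) γ t x ↔
      ∃ w ∈ G x, v = w + ∑ i, γ t i • euclCol B i := by
    intro t x v
    simp only [closedLoop, hG, signField, mem_ofPred_eq, hgrad]
    constructor
    · rintro ⟨s, hs, rfl⟩; exact ⟨_, ⟨s, hs, rfl⟩, rfl⟩
    · rintro ⟨_, ⟨s, hs, rfl⟩, rfl⟩; exact ⟨s, hs, rfl⟩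
  set S : ℝ := ∑ i, ρ i * ‖euclCol B i‖ with hS
  have hS0 : 0 ≤ S := Finset.sum_nonneg fun i _ => mul_nonneg (hρ i) (norm_nonneg _)
  -- Extension by zero, so that measurability and the bound hold on all of `ℝ`.
  set γ' : ℝ → Fin m → ℝ := fun t i => (Ici (0 : ℝ)).indicator (fun t => γ t i) t with hγ'
  have hγ'eq : ∀ t, 0 ≤ t → γ' t = γ t := fun t ht => by
    ext i; exact indicator_of_mem (mem_Ici.2 ht) _
  have hγ'le : ∀ t i, |γ' t i| ≤ ρ i := fun t i => by
    by_cases ht : 0 ≤ t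
    · rw [hγ'eq t ht]; exact (hγ i t ht).le
    · rw [show γ' t i = 0 from indicator_of_notMem (by simpa using ht) _, abs_zero]; exact hρ i
  set u : ℝ → EuclideanSpace ℝ (Fin n) := fun t => ∑ i, γ' t i • euclCol B i with hu
  have hu_meas : AEStronglyMeasurable u volume := by
    refine Finset.aestronglyMeasurable_fun_sum _ fun i _ => ?_
    exact (((aemeasurable_indicator_iff measurableSet_Ici).2 (hγ_meas i)).smul_const
      _).aestronglyMeasurable
  have hu_le : ∀ t, ‖u t‖ ≤ S := fun t => norm_sum_le_of_le _ fun i _ => by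
    rw [norm_smul, Real.norm_eq_abs]; gcongr; exact hγ'le t i
  -- One `S` covers the sign terms and the other the disturbance, so `L` bounds the growth of `G`,
  -- the full right-hand side, and the slope of `Γ`.
  set L : NNReal := Real.toNNReal (‖f 0‖ + Lf + 2 * S) with hLdef
  have hL : (L : ℝ) = ‖f 0‖ + Lf + 2 * S := Real.coe_toNNReal _ (by positivity)
  have hfbd : ∀ x, ‖f x‖ ≤ ‖f 0‖ + Lf * ‖x‖ := fun x => by
    have h1 := hf.norm_sub_le x 0
    rw [sub_zero] at h1
    linarith [norm_sub_norm_le (f x) (f 0)]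
  have hGbd' : ∀ x, ∀ v ∈ G x, ‖v‖ + S ≤ L * (1 + ‖x‖) := fun x v hv => by
    have h1 := norm_le_of_mem_signField hv
    simp only [abs_of_nonneg (hρ _)] at h1
    rw [hL]
    nlinarith [hfbd x, norm_nonneg x, norm_nonneg (f 0), Lf.coe_nonneg,
      mul_nonneg (norm_nonneg (f 0)) (norm_nonneg x), mul_nonneg hS0 (norm_nonneg x)]
  have hu_le' : ∀ t, ‖u t‖ ≤ L := fun t => by
    have := hu_le t
    rw [hL]; linarith [norm_nonneg (f 0), Lf.coe_nonneg]
  set Γ : ℝ → EuclideanSpace ℝ (Fin n) := fun t => ∫ τ in (0 : ℝ)..t, u τ with hΓdef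
  have hΓ : LipschitzWith L Γ := lipschitzWith_integral_of_norm_le hu_meas hu_le'
  have hK : 0 ≤ ‖A‖ * Lf := by positivity
  have hGA : ∀ x y, ∀ v ∈ G x, ∀ w ∈ G y,
      inner ℝ (A (x - y)) (v - w) ≤ ‖A‖ * Lf * ‖x - y‖ ^ 2 := fun x y v hv w hw =>
    inner_signField_sub_le (f := f) (A := A) (b := euclCol B) hf hρ hv hw
  obtain ⟨y, hy0, hylip, hyG⟩ := exists_lipschitz_arc_deriv_mem hA hc hcA hK (G := G)
    signField_nonempty convex_signField isClosed_signField
    (fun x v hv => by linarith [hGbd' x v hv])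
    hGA
    (fun x ε hε => eventually_signField_subset hf.continuous x hε) hΓ (by simp [hΓdef]) x₀
  have hxlip : ∀ T : ℝ, ∃ M : NNReal, LipschitzOnWith M (fun t => y t + Γ t) (Icc 0 T) := by
    intro T
    obtain ⟨M, hM⟩ := hylip T
    exact ⟨M + L, hM.add hΓ.lipschitzOnWith⟩
  have hsol : IsSolution (closedLoop f B ρ (quadV P) γ) x₀ (fun t => y t + Γ t) := by
    refine ⟨by simp [hy0, hΓdef], fun T hT => ?_, ?_⟩
    · obtain ⟨M, hM⟩ := hxlip T
      exact LipschitzOnWith.absolutelyContinuousOnInterval (by rwa [uIcc_of_le hT])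
    · rw [ae_restrict_iff' measurableSet_Ioi]
      have hloc := locallyIntegrable_of_norm_le hu_meas hu_le
      filter_upwards [ae_hasDerivAt_of_lipschitzOnWith_Icc hylip,
        _root_.LocallyIntegrable.ae_hasDerivAt_integral hloc] with t h1 h2 ht
      have h3 : HasDerivAt Γ (u t) t := h2 0
      refine ⟨deriv y t + u t, (hFG _ _ _).2 ⟨_, hyG t ht _ (h1 ht), ?_⟩, (h1 ht).add h3⟩
      simp only [hu, hγ'eq t (le_of_lt ht)]
  refine ⟨fun t => y t + Γ t, hsol, fun T _ => hxlip T, fun hV => ?_, fun z hz => ?_⟩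
  · refine hsol.exists_lipschitzOnWith_Ici hA hc hcA (L := L) (fun t ht x v hv => ?_)
      fun t ht x v hv => ?_
    · obtain ⟨w, hw, rfl⟩ := (hFG _ _ _).1 hv
      have h1 := hu_le t
      simp only [hu, hγ'eq t ht.le] at h1
      linarith [norm_add_le w (∑ i, γ t i • euclCol B i), hGbd' x w hw]
    · obtain ⟨w, hw, rfl⟩ := (hFG _ _ _).1 hv
      exact inner_add_sum_smul_nonpos_of_mem_signField (fun i => (hγ i t ht.le).le)
        (by rw [← hgrad]; exact hV x) hw
  · refine hz.eqOn hA hc hcA hK (fun t _ x y v hv w hw => ?_) hsol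
    obtain ⟨v', hv', rfl⟩ := (hFG _ _ _).1 hv
    obtain ⟨w', hw', rfl⟩ := (hFG _ _ _).1 hw
    rw [add_sub_add_right_eq_sub]
    exact hGA x y v' hv' w' hw'
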